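/- Let $W$ denote a binary-input memoryless channel with finite output alphabet $\mathcal Y$, i.e. transition probabilities $W(y\mid x)\ge 0$ for $x\in\{0,1\}$, $y\in\mathcal Y$, with $\sum_{y}W(y\mid x)=1$ for each $x$ (no symmetry is required; binary-input symmetric channels are a special case). Let $I(W)=I(X;Y)=1-H(X\mid Y)$, in bits, where $X$ is uniform on $\{0,1\}$ and $Y$ is the output of $W$ on input $X$, and let $Z(W)=\sum_{y\in\mathcal Y}\sqrt{W(y\mid 0)W(y\mid 1)}$ be the Bhattacharyya parameter. Define the channels $$W^-(y_1,y_2\mid x_1)=\sum_{x_2\in\{0,1\}}\tfrac12 W(y_1\mid x_1\oplus x_2)W(y_2\mid x_2),\qquad W^+(y_1,y_2,x_1\mid x_2)=\tfrac12 W(y_1\mid x_1\oplus x_2)W(y_2\mid x_2),$$ with output alphabets $\mathcal Y^2$ and $\mathcal Y^2\times\{0,1\}$, and recursively, for $0\le i<2^{n}$, the channels $W_n^{(i)}$ by $W_0^{(0)}=W$ and, for $0\le i<2^{n+1}$, $W_{n+1}^{(i)}=(W_n^{(\lfloor i/2\rfloor)})^-$ if $i$ is even, $W_{n+1}^{(i)}=(W_n^{(\lfloor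 i/2\rfloor)})^+$ if $i$ is odd. For every $\delta\in(0,1/2)$ there is a constant $c_\delta>0$, depending only on $\delta$, such that for every such channel $W$, every $\varepsilon>0$ and every integer $n_0\ge 0$ with $n_0>c_\delta\log(1/\varepsilon)$, $$\Pr_i\left[Z\big(W_{n_0}^{(i)}\big)\le 2^{-2^{\delta n_0}}\right]\ \ge\ I(W)-\varepsilon,$$ where $i$ is uniformly distributed on $\{0,1,\dots,2^{n_0}-1\}$. -/

import Mathlib

universe u

/-- A binary-input memoryless channel with finite output alphabet, given by its transition
probabilities: `prob x y` is `W(y | x)`. -/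
structure BinaryChannel : Type (u + 1) where
  Output : Type u
  [fintypeOutput : Fintype Output]
  prob : Bool → Output → ℝ
  prob_nonneg : ∀ x y, 0 ≤ prob x y
  sum_prob : ∀ x, ∑ y, prob x y = 1

namespace BinaryChannel

attribute [instance] BinaryChannel.fintypeOutput

/-- `P(Y = y)` when the input `X` is uniform on `{0, 1}`. -/
noncomputable def outputProb (W : BinaryChannel.{u}) (y : W.Output) : ℝ :=
  ∑ x, (1 / 2) * W.prob x y

/-- `P(X = x | Y = y)` when the input `X` is uniform on `{0, 1}`. Where `P(Y = y) = 0` the value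
is irrelevant, since it is only used with weight `P(Y = y)`. -/
noncomputable def posterior (W : BinaryChannel.{u}) (x : Bool) (y : W.Output) : ℝ :=
  (1 / 2) * W.prob x y / W.outputProb y

/-- `H(W) = H(X | Y)`, in bits, for a uniform input `X` with channel output `Y`. -/
noncomputable def entropy (W : BinaryChannel.{u}) : ℝ :=
  ∑ y, W.outputProb y * ∑ x, Real.negMulLog (W.posterior x y) / Real.log 2

/-- `I(W) = I(X; Y) = H(X) - H(X | Y) = 1 - H(W)`, in bits, for a uniform input `X`. -/
noncomputable def mutualInfo (W : BinaryChannel.{u}) : ℝ :=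
  1 - W.entropy

/-- The Bhattacharyya parameter `Z(W)`. -/
noncomputable def bhattacharyya (W : BinaryChannel.{u}) : ℝ :=
  ∑ y, √(W.prob false y * W.prob true y)

/-- `W⁻(y₁, y₂ | x₁) = ∑ x₂, (1/2) W(y₁ | x₁ ⊕ x₂) W(y₂ | x₂)`. -/
noncomputable def minus (W : BinaryChannel.{u}) : BinaryChannel.{u} where
  Output := W.Output × W.Output
  prob x₁ y := ∑ x₂, (1 / 2) * W.prob (x₁ ^^ x₂) y.1 * W.prob x₂ y.2
  prob_nonneg x₁ y := Finset.sum_nonneg fun x₂ _ =>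
    mul_nonneg (mul_nonneg (by norm_num) (W.prob_nonneg _ _)) (W.prob_nonneg _ _)
  sum_prob x₁ := by
    rw [Finset.sum_comm]
    simp only [Fintype.sum_prod_type, ← Finset.mul_sum, W.sum_prob, mul_one]
    norm_num

/-- `W⁺(y₁, y₂, x₁ | x₂) = (1/2) W(y₁ | x₁ ⊕ x₂) W(y₂ | x₂)`. -/
noncomputable def plus (W : BinaryChannel.{u}) : BinaryChannel.{u} where
  Output := W.Output × W.Output × Bool
  prob x₂ y := (1 / 2) * W.prob (y.2.2 ^^ x₂) y.1 * W.prob x₂ y.2.1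
  prob_nonneg x₂ y :=
    mul_nonneg (mul_nonneg (by norm_num) (W.prob_nonneg _ _)) (W.prob_nonneg _ _)
  sum_prob x₂ := by
    simp only [Fintype.sum_prod_type]
    rw [Finset.sum_comm]
    simp only [Fintype.sum_bool, Finset.sum_add_distrib, ← Finset.mul_sum, ← Finset.sum_mul,
      W.sum_prob]
    norm_num [W.sum_prob]

/-- The channel `W_n^{(i)}`, meaningful for `0 ≤ i < 2 ^ n`: `W_0^{(0)} = W`, and
`W_{n+1}^{(i)}` is `(W_n^{(⌊i/2⌋)})⁻` for even `i` and `(W_n^{(⌊i/2⌋)})⁺` for odd `i`. -/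
noncomputable def bitChannel (W : BinaryChannel.{u}) : ℕ → ℕ → BinaryChannel.{u}
  | 0, _ => W
  | n + 1, i => if i % 2 = 0 then (W.bitChannel n (i / 2)).minus else (W.bitChannel n (i / 2)).plus

end BinaryChannel

/-!
The proof follows the random process `W_n^{(i)}` with `i` uniform; `W.bitAverage n g` is the
expectation of `g (W_n^{(i)})`. The `n` steps are split into a short first stage, a small fraction
`γ` of them, and a long second stage.

*Rough polarization.* For one step, `Z(W⁺) = Z²`, while `Z(W⁻) ≤ 2 Z - Z²` and
`1 - Z(W⁻)² ≤ (1 - Z²)²`; the last bound, an instance of the triangle inequality in the plane, is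
what makes the argument work without symmetry of the channel. These three facts imply that the
potential `√(Z (1 - Z))` contracts on average by the factor `19 / 20` (`sqrt_bhattacharyya_step`).
Since `I` is a martingale (`mutualInfo_minus_add_mutualInfo_plus`, the chain rule for entropy) and
`I² + Z² ≤ 1` (`sq_mutualInfo_le`), after `m` steps a fraction at least `I(W)` of the channels, up
to an exponentially small error, satisfies `Z ≤ (19 / 20) ^ m` (`mutualInfo_le_bitAverage_rough`).

*Fast polarization.* Write `Z = 2 ^ (-L)`. A plus step doubles `L`, and a minus step lowers it by at
most `1`. Starting from `L` proportional to `m`, the exponent stays above a constant `K` outside an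
event of probability exponentially small in `m`, because `√Z` is a supermartingale where `Z` is
small. Above `K`, the power `L ^ (-s)` contracts on average by a factor that is close to
`2 ^ (-s / 2)` for small `s` and large `K`. Markov's inequality then gives `L ≥ 2 ^ (δ n)` outside
an event of probability exponentially small in `n`, for every `δ < 1 / 2` (`bitAverage_bad_le`,
`exists_contraction_factor_le`).

Together these bound the error by `C * q ^ n` with `q < 1`
(`exists_mutualInfo_le_bitAverage_fast`). The constant `C` is harmless for large `n`; for the
finitely many remaining `n`, a large `c` makes the claim trivial unless `I(W)` is so close to `1`
that all `2 ^ n` synthesized channels are good.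
-/

/-! ### One polarization step -/

namespace BinaryChannel

theorem bhattacharyya_nonneg (W : BinaryChannel.{u}) : 0 ≤ W.bhattacharyya :=
  Finset.sum_nonneg fun _ _ => Real.sqrt_nonneg _

theorem outputProb_eq (W : BinaryChannel.{u}) (y : W.Output) :
    W.outputProb y = (W.prob false y + W.prob true y) / 2 := by
  simp only [outputProb, Fintype.sum_bool]; ring

theorem outputProb_nonneg (W : BinaryChannel.{u}) (y : W.Output) : 0 ≤ W.outputProb y := by
  have h₀ := W.prob_nonneg false y
  have h₁ := W.prob_nonneg true y
  rw [outputProb_eq]; positivity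

theorem sum_outputProb (W : BinaryChannel.{u}) : ∑ y, W.outputProb y = 1 := by
  simp only [outputProb_eq, ← Finset.sum_div, Finset.sum_add_distrib, W.sum_prob]; norm_num

theorem sqrt_prob_mul_le_outputProb (W : BinaryChannel.{u}) (y : W.Output) :
    √(W.prob false y * W.prob true y) ≤ W.outputProb y := by
  rw [outputProb_eq]
  have h₀ := W.prob_nonneg false y
  have h₁ := W.prob_nonneg true y
  apply Real.sqrt_le_iff.2 ⟨by positivity, ?_⟩
  nlinarith [sq_nonneg (W.prob false y - W.prob true y)]

theorem bhattacharyya_le_one (W : BinaryChannel.{u}) : W.bhattacharyya ≤ 1 := by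
  rw [← W.sum_outputProb]
  exact Finset.sum_le_sum fun y _ => W.sqrt_prob_mul_le_outputProb y

theorem bhattacharyya_plus (W : BinaryChannel.{u}) :
    W.plus.bhattacharyya = W.bhattacharyya ^ 2 := by
  have key : ∀ (y₁ y₂ : W.Output) (u : Bool),
      √(W.plus.prob false (y₁, y₂, u) * W.plus.prob true (y₁, y₂, u)) =
        (1 / 2) * (√(W.prob false y₁ * W.prob true y₁) * √(W.prob false y₂ * W.prob true y₂)) := by
    intro y₁ y₂ u
    have h : W.plus.prob false (y₁, y₂, u) * W.plus.prob true (y₁, y₂, u) =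
        (1 / 2) ^ 2 * ((W.prob false y₁ * W.prob true y₁) *
          (W.prob false y₂ * W.prob true y₂)) := by
      cases u <;> simp [plus] <;> ring
    rw [h, Real.sqrt_mul (by norm_num), Real.sqrt_sq (by norm_num),
      Real.sqrt_mul (mul_nonneg (W.prob_nonneg _ _) (W.prob_nonneg _ _))]
  change ∑ y : W.Output × W.Output × Bool, _ = _
  simp only [Fintype.sum_prod_type, key, Fintype.sum_bool]
  simp only [bhattacharyya, sq, Finset.sum_mul_sum]
  exact Finset.sum_congr rfl fun _ _ => Finset.sum_congr rfl fun _ _ => by ring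

/-- In terms of `q = P(Y = y)` and `s = √(W(y | 0) W(y | 1))`, the Bhattacharyya summand of `W⁻` at
`(y₁, y₂)` is `√(s₁² q₂² + s₂² q₁² - s₁² s₂²)`. -/
theorem bhattacharyya_minus_eq (W : BinaryChannel.{u}) :
    W.minus.bhattacharyya = ∑ y₂, ∑ y₁,
      √((√(W.prob false y₂ * W.prob true y₂) * W.outputProb y₁) ^ 2 +
        (√(W.outputProb y₂ ^ 2 - √(W.prob false y₂ * W.prob true y₂) ^ 2) *
          √(W.prob false y₁ * W.prob true y₁)) ^ 2) := by
  change ∑ y : W.Output × W.Output, _ = _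
  rw [Fintype.sum_prod_type, Finset.sum_comm]
  refine Finset.sum_congr rfl fun y₂ _ => Finset.sum_congr rfl fun y₁ _ => ?_
  have ha := W.prob_nonneg false y₁
  have hb := W.prob_nonneg true y₁
  have hc := W.prob_nonneg false y₂
  have hd := W.prob_nonneg true y₂
  have hst := pow_le_pow_left₀ (Real.sqrt_nonneg _) (W.sqrt_prob_mul_le_outputProb y₂) 2
  rw [mul_pow, mul_pow, Real.sq_sqrt (sub_nonneg.2 hst), Real.sq_sqrt (by positivity),
    Real.sq_sqrt (by positivity), outputProb_eq, outputProb_eq]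
  congr 1
  simp [minus]
  ring

theorem bhattacharyya_minus_le (W : BinaryChannel.{u}) :
    W.minus.bhattacharyya ≤ 2 * W.bhattacharyya - W.bhattacharyya ^ 2 := by
  have key : ∀ y₂ y₁ : W.Output,
      √((√(W.prob false y₂ * W.prob true y₂) * W.outputProb y₁) ^ 2 +
        (√(W.outputProb y₂ ^ 2 - √(W.prob false y₂ * W.prob true y₂) ^ 2) *
          √(W.prob false y₁ * W.prob true y₁)) ^ 2) ≤
      √(W.prob false y₂ * W.prob true y₂) * W.outputProb y₁ +
        W.outputProb y₂ * √(W.prob false y₁ * W.prob true y₁) -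
        √(W.prob false y₂ * W.prob true y₂) * √(W.prob false y₁ * W.prob true y₁) := by
    intro y₂ y₁
    have h₁ := W.sqrt_prob_mul_le_outputProb y₁
    have h₂ := W.sqrt_prob_mul_le_outputProb y₂
    have hst := pow_le_pow_left₀ (Real.sqrt_nonneg _) h₂ 2
    have e := Real.sq_sqrt (sub_nonneg.2 hst)
    generalize √(W.outputProb y₂ ^ 2 - √(W.prob false y₂ * W.prob true y₂) ^ 2) = r at *
    have hs := Real.sqrt_nonneg (W.prob false y₁ * W.prob true y₁)
    have ht := Real.sqrt_nonneg (W.prob false y₂ * W.prob true y₂)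
    generalize √(W.prob false y₁ * W.prob true y₁) = s at *
    generalize √(W.prob false y₂ * W.prob true y₂) = t at *
    generalize W.outputProb y₁ = p at *
    generalize W.outputProb y₂ = q at *
    refine Real.sqrt_le_iff.2 ⟨?_, ?_⟩
    · nlinarith [mul_nonneg ht (sub_nonneg.2 h₁), mul_nonneg (ht.trans h₂) hs]
    · rw [mul_pow r, e]
      nlinarith [mul_nonneg (mul_nonneg hs ht) (mul_nonneg (sub_nonneg.2 h₁) (sub_nonneg.2 h₂))]
  rw [bhattacharyya_minus_eq]
  refine (Finset.sum_le_sum fun y₂ _ => Finset.sum_le_sum fun y₁ _ => key y₂ y₁).trans_eq ?_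
  simp only [Finset.sum_sub_distrib, Finset.sum_add_distrib, ← Finset.mul_sum, ← Finset.sum_mul,
    sum_outputProb]
  simp only [bhattacharyya]
  ring

theorem _root_.Finset.sqrt_sq_sum_add_sq_sum_le {ι : Type*} (S : Finset ι) (u v : ι → ℝ) :
    √((∑ i ∈ S, u i) ^ 2 + (∑ i ∈ S, v i) ^ 2) ≤ ∑ i ∈ S, √(u i ^ 2 + v i ^ 2) := by
  have h := norm_sum_le S fun i => (⟨u i, v i⟩ : ℂ)
  simp only [Complex.norm_eq_sqrt_sq_add_sq, Complex.re_sum, Complex.im_sum] at h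
  exact h

/-- Applying the triangle inequality in `ℝ²` to the sum over `y₁`, then to the sum over `y₂`, gives
`Z(W⁻)² ≥ 2 Z(W)² - Z(W)⁴`. -/
theorem one_sub_sq_bhattacharyya_minus_le (W : BinaryChannel.{u}) :
    1 - W.minus.bhattacharyya ^ 2 ≤ (1 - W.bhattacharyya ^ 2) ^ 2 := by
  have hz0 := W.bhattacharyya_nonneg
  have hz1 : 0 ≤ 1 - W.bhattacharyya ^ 2 := by nlinarith [W.bhattacharyya_le_one]
  have h : √(W.bhattacharyya ^ 2 + (√(1 - W.bhattacharyya ^ 2) * W.bhattacharyya) ^ 2) ≤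
      W.minus.bhattacharyya := by
    rw [bhattacharyya_minus_eq]
    calc _ = √((∑ y₂, W.bhattacharyya * W.outputProb y₂) ^ 2 +
          (∑ y₂, √(1 - W.bhattacharyya ^ 2) * √(W.prob false y₂ * W.prob true y₂)) ^ 2) := by
          rw [← Finset.mul_sum, ← Finset.mul_sum, sum_outputProb, mul_one, ← bhattacharyya]
      _ ≤ _ := (Finset.sqrt_sq_sum_add_sq_sum_le _ _ _).trans (Finset.sum_le_sum fun y₂ _ => ?_)
    refine le_trans (le_of_eq ?_) (Finset.sqrt_sq_sum_add_sq_sum_le _ _ _)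
    have hst := pow_le_pow_left₀ (Real.sqrt_nonneg _) (W.sqrt_prob_mul_le_outputProb y₂) 2
    rw [← Finset.mul_sum, ← Finset.mul_sum, sum_outputProb, ← bhattacharyya]
    congr 1
    rw [mul_pow √_, mul_pow √_, mul_pow √_, Real.sq_sqrt (sub_nonneg.2 hst), Real.sq_sqrt hz1]
    ring
  have h2 := (Real.sqrt_le_left W.minus.bhattacharyya_nonneg).1 h
  rw [mul_pow, Real.sq_sqrt hz1] at h2
  nlinarith

/-- The conditional entropy as the joint entropy minus the output entropy. -/
theorem entropy_eq (W : BinaryChannel.{u}) :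
    W.entropy = (∑ y, ∑ x, Real.negMulLog (W.prob x y / 2) -
      ∑ y, Real.negMulLog (W.outputProb y)) / Real.log 2 := by
  rw [← Finset.sum_sub_distrib, Finset.sum_div, entropy]
  refine Finset.sum_congr rfl fun y _ => ?_
  rw [← Finset.sum_div, ← mul_div_assoc]
  congr 1
  rcases eq_or_ne (W.outputProb y) 0 with h | h
  · have h₀ := W.prob_nonneg false y
    have h₁ := W.prob_nonneg true y
    rw [outputProb_eq] at h
    have e₀ : W.prob false y = 0 := by linarith
    have e₁ : W.prob true y = 0 := by linarith
    simp [outputProb_eq, e₀, e₁]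
  · have key : ∀ x, Real.negMulLog (W.prob x y / 2) =
        W.posterior x y * Real.negMulLog (W.outputProb y) +
          W.outputProb y * Real.negMulLog (W.posterior x y) := by
      intro x
      rw [← Real.negMulLog_mul]
      congr 1
      rw [posterior]; field_simp
    have hp : ∑ x, W.posterior x y = 1 := by
      simp only [posterior, ← Finset.sum_div]
      rw [← outputProb, div_self h]
    simp only [key, Finset.sum_add_distrib, ← Finset.mul_sum, ← Finset.sum_mul, hp]
    ring

theorem outputProb_minus (W : BinaryChannel.{u}) (y : W.Output × W.Output) :
    W.minus.outputProb y = W.outputProb y.1 * W.outputProb y.2 := by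
  simp only [outputProb, minus, Fintype.sum_bool, Bool.xor_true, Bool.xor_false, Bool.not_true,
    Bool.not_false]
  ring

theorem outputProb_plus (W : BinaryChannel.{u}) (y : W.Output × W.Output × Bool) :
    W.plus.outputProb y = W.minus.prob y.2.2 (y.1, y.2.1) / 2 := by
  simp only [outputProb, minus, plus, Fintype.sum_bool]
  ring

theorem _root_.Real.sum_sum_negMulLog_mul {ι κ : Type*} (S : Finset ι) (T : Finset κ)
    (p : ι → ℝ) (q : κ → ℝ) (hp : ∑ i ∈ S, p i = 1) (hq : ∑ j ∈ T, q j = 1) :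
    ∑ i ∈ S, ∑ j ∈ T, Real.negMulLog (p i * q j) =
      ∑ i ∈ S, Real.negMulLog (p i) + ∑ j ∈ T, Real.negMulLog (q j) := by
  simp only [Real.negMulLog_mul, Finset.sum_add_distrib, ← Finset.mul_sum, ← Finset.sum_mul, hp, hq,
    one_mul]

/-- Conservation of entropy. By the chain rule, both sides are the conditional entropy of the two
inputs of two independent uses of `W` given the two outputs. -/
theorem entropy_minus_add_entropy_plus (W : BinaryChannel.{u}) :
    W.minus.entropy + W.plus.entropy = 2 * W.entropy := by
  have hcancel : ∑ y, Real.negMulLog (W.plus.outputProb y) =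
      ∑ y, ∑ x, Real.negMulLog (W.minus.prob x y / 2) := by
    refine (Finset.sum_congr rfl fun y _ => congrArg _ (W.outputProb_plus y)).trans ?_
    change ∑ y : W.Output × W.Output × Bool, _ = ∑ y : W.Output × W.Output, _
    simp only [Fintype.sum_prod_type]
  have hout : ∑ y, Real.negMulLog (W.minus.outputProb y) =
      2 * ∑ y, Real.negMulLog (W.outputProb y) := by
    refine (Finset.sum_congr rfl fun y _ => congrArg _ (W.outputProb_minus y)).trans ?_
    change ∑ y : W.Output × W.Output, _ = _
    rw [Fintype.sum_prod_type, Real.sum_sum_negMulLog_mul _ _ _ _ W.sum_outputProb W.sum_outputProb]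
    ring
  have hjoint : ∑ y, ∑ x, Real.negMulLog (W.plus.prob x y / 2) =
      2 * ∑ y, ∑ x, Real.negMulLog (W.prob x y / 2) := by
    have hs : ∑ i : W.Output × Bool, W.prob i.2 i.1 / 2 = 1 := by
      rw [Fintype.sum_prod_type, ← W.sum_outputProb]
      exact Finset.sum_congr rfl fun y _ => by simp only [outputProb, Fintype.sum_bool]; ring
    have h := Real.sum_sum_negMulLog_mul Finset.univ Finset.univ _ _ hs hs
    rw [two_mul, ← Fintype.sum_prod_type' (f := fun y x => Real.negMulLog (W.prob x y / 2)), ← h]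
    change ∑ y : W.Output × W.Output × Bool, _ = _
    simp only [Fintype.sum_prod_type, plus]
    refine Finset.sum_congr rfl fun y₁ _ => ?_
    rw [Finset.sum_comm (s := (Finset.univ : Finset Bool))]
    refine Finset.sum_congr rfl fun y₂ _ => ?_
    have e : ∀ a b : ℝ, 1 / 2 * a * b / 2 = a / 2 * (b / 2) := fun a b => by ring
    simp only [Fintype.sum_bool, e, Bool.xor_true, Bool.xor_false, Bool.not_true, Bool.not_false]
    ring
  rw [entropy_eq W, entropy_eq W.minus, entropy_eq W.plus, hcancel, hout, hjoint]
  ring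

theorem mutualInfo_minus_add_mutualInfo_plus (W : BinaryChannel.{u}) :
    (W.minus.mutualInfo + W.plus.mutualInfo) / 2 = W.mutualInfo := by
  simp only [mutualInfo]
  linarith [W.entropy_minus_add_entropy_plus]

/-- By concavity, the binary entropy of `(p, 1 - p)` is at least `2 min(p, 1 - p)` bits. -/
theorem _root_.Real.one_sub_abs_mul_log_two_le {p q : ℝ} (hp : 0 ≤ p) (hq : 0 ≤ q)
    (h : p + q = 1) :
    (1 - |p - q|) * Real.log 2 ≤ Real.negMulLog p + Real.negMulLog q := by
  wlog hpq : p ≤ q generalizing p q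
  · have := this hq hp (by linarith) (by linarith)
    rw [abs_sub_comm]; linarith
  have hc := Real.concaveOn_negMulLog.2
  have h2 : Real.negMulLog (1 / 2) = Real.log 2 / 2 := by
    rw [Real.negMulLog, one_div, Real.log_inv]; ring
  have h₁ := hc (x := 1 / 2) (by simp) (y := 0) (by simp) (a := 2 * p) (b := 1 - 2 * p)
    (by linarith) (by linarith) (by ring)
  have h₂ := hc (x := 1 / 2) (by simp) (y := 1) (by simp) (a := 2 * p) (b := 1 - 2 * p)
    (by linarith) (by linarith) (by ring)
  have e₁ : (2 * p) • (1 / 2 : ℝ) + (1 - 2 * p) • (0 : ℝ) = p := by simp only [smul_eq_mul]; ring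
  have e₂ : (2 * p) • (1 / 2 : ℝ) + (1 - 2 * p) • (1 : ℝ) = q := by simp only [smul_eq_mul]; linarith
  rw [e₁] at h₁
  rw [e₂] at h₂
  simp only [h2, smul_eq_mul, Real.negMulLog_zero, Real.negMulLog_one] at h₁ h₂
  rw [abs_of_nonpos (by linarith), ← h]
  linarith

theorem posterior_nonneg (W : BinaryChannel.{u}) (x : Bool) (y : W.Output) :
    0 ≤ W.posterior x y :=
  div_nonneg (mul_nonneg (by norm_num) (W.prob_nonneg _ _)) (W.outputProb_nonneg _)

theorem outputProb_mul_posterior (W : BinaryChannel.{u}) (x : Bool) (y : W.Output) :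
    W.outputProb y * W.posterior x y = W.prob x y / 2 := by
  rcases eq_or_ne (W.outputProb y) 0 with h | h
  · have h₀ := W.prob_nonneg false y
    have h₁ := W.prob_nonneg true y
    rw [h, zero_mul]
    rw [outputProb_eq] at h
    cases x <;> linarith
  · rw [posterior]; field_simp

/-- The mutual information is at most the total variation distance between `W(· | 0)` and
`W(· | 1)`. -/
theorem mutualInfo_le_sum_abs (W : BinaryChannel.{u}) :
    W.mutualInfo ≤ ∑ y, |W.prob true y - W.prob false y| / 2 := by
  have hlog : 0 < Real.log 2 := Real.log_pos (by norm_num)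
  rw [mutualInfo, entropy, sub_le_iff_le_add, ← Finset.sum_add_distrib, ← W.sum_outputProb]
  refine Finset.sum_le_sum fun y _ => ?_
  rcases eq_or_ne (W.outputProb y) 0 with h | h
  · rw [h, zero_mul, add_zero]; positivity
  have hs : W.posterior true y + W.posterior false y = 1 := by
    apply mul_left_cancel₀ h
    rw [mul_add, outputProb_mul_posterior, outputProb_mul_posterior, outputProb_eq]; ring
  have hb := Real.one_sub_abs_mul_log_two_le (W.posterior_nonneg true y)
    (W.posterior_nonneg false y) hs
  have e : |W.prob true y - W.prob false y| / 2 =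
      W.outputProb y * |W.posterior true y - W.posterior false y| := by
    have := abs_mul (W.outputProb y) (W.posterior true y - W.posterior false y)
    rw [abs_of_nonneg (W.outputProb_nonneg y)] at this
    rw [← this, mul_sub, outputProb_mul_posterior, outputProb_mul_posterior, ← sub_div, abs_div,
      abs_two]
  rw [e, ← mul_add, Fintype.sum_bool, ← add_div]
  refine le_mul_of_one_le_right (W.outputProb_nonneg y) ?_
  have := (le_div_iff₀ hlog).2 hb
  linarith

theorem sq_mutualInfo_le {W : BinaryChannel.{u}} (h : 0 ≤ W.mutualInfo) :
    W.mutualInfo ^ 2 ≤ 1 - W.bhattacharyya ^ 2 := by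
  have h₁ := W.mutualInfo_le_sum_abs
  have h₂ := Finset.sqrt_sq_sum_add_sq_sum_le Finset.univ
    (fun y => |W.prob true y - W.prob false y| / 2) (fun y => √(W.prob false y * W.prob true y))
  have h₃ : ∀ y, √((|W.prob true y - W.prob false y| / 2) ^ 2 +
      √(W.prob false y * W.prob true y) ^ 2) = W.outputProb y := by
    intro y
    rw [Real.sq_sqrt (mul_nonneg (W.prob_nonneg _ _) (W.prob_nonneg _ _)), div_pow, sq_abs,
      ← Real.sqrt_sq (W.outputProb_nonneg y), outputProb_eq]
    congr 1; ring
  simp only [h₃, sum_outputProb] at h₂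
  have h₄ := (Real.sqrt_le_left zero_le_one).1 h₂
  rw [← bhattacharyya] at h₄
  have := pow_le_pow_left₀ h h₁ 2
  linarith

theorem mutualInfo_le_one (W : BinaryChannel.{u}) : W.mutualInfo ≤ 1 := by
  rcases lt_or_ge W.mutualInfo 0 with h | h
  · linarith
  · nlinarith [sq_mutualInfo_le h, sq_nonneg W.bhattacharyya]

end BinaryChannel

/-! ### Averages over the synthesized channels -/

namespace BinaryChannel

/-- The expectation of `g (W_n^{(i)})` for `i` uniform on `{0, …, 2 ^ n - 1}`. -/
noncomputable def bitAverage (W : BinaryChannel.{u}) (n : ℕ) (g : BinaryChannel.{u} → ℝ) : ℝ :=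
  (∑ i ∈ Finset.range (2 ^ n), g (W.bitChannel n i)) / 2 ^ n

theorem bitAverage_zero (W : BinaryChannel.{u}) (g : BinaryChannel.{u} → ℝ) :
    W.bitAverage 0 g = g W := by
  simp [bitAverage, bitChannel]

theorem bitAverage_mono (W : BinaryChannel.{u}) (n : ℕ) {g h : BinaryChannel.{u} → ℝ}
    (hgh : ∀ V, g V ≤ h V) : W.bitAverage n g ≤ W.bitAverage n h :=
  div_le_div_of_nonneg_right (Finset.sum_le_sum fun _ _ => hgh _) (by positivity)

theorem bitAverage_const (W : BinaryChannel.{u}) (n : ℕ) (a : ℝ) :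
    W.bitAverage n (fun _ => a) = a := by
  simp [bitAverage]

theorem bitAverage_add (W : BinaryChannel.{u}) (n : ℕ) (g h : BinaryChannel.{u} → ℝ) :
    W.bitAverage n (fun V => g V + h V) = W.bitAverage n g + W.bitAverage n h := by
  simp only [bitAverage, Finset.sum_add_distrib, add_div]

theorem bitAverage_const_mul (W : BinaryChannel.{u}) (n : ℕ) (a : ℝ)
    (g : BinaryChannel.{u} → ℝ) :
    W.bitAverage n (fun V => a * g V) = a * W.bitAverage n g := by
  simp only [bitAverage, ← Finset.mul_sum, mul_div_assoc]

theorem _root_.Finset.sum_range_two_mul {M : Type*} [AddCommMonoid M] (F : ℕ → M) (N : ℕ) :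
    ∑ i ∈ Finset.range (2 * N), F i = ∑ j ∈ Finset.range N, (F (2 * j) + F (2 * j + 1)) := by
  induction N with
  | zero => simp
  | succ N ih =>
    rw [mul_add, mul_one, Finset.sum_range_succ, Finset.sum_range_succ, ih, Finset.sum_range_succ,
      add_assoc]

theorem bitAverage_succ (W : BinaryChannel.{u}) (n : ℕ) (g : BinaryChannel.{u} → ℝ) :
    W.bitAverage (n + 1) g = W.bitAverage n fun V => (g V.minus + g V.plus) / 2 := by
  have h₁ : ∀ j, (2 * j + 1) / 2 = j := fun j => by omega
  have h₂ : ∀ j, (2 * j + 1) % 2 = 1 := fun j => by omega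
  simp only [bitAverage, pow_succ', Finset.sum_range_two_mul, bitChannel, Nat.mul_mod_right, h₁, h₂,
    Nat.mul_div_cancel_left _ two_pos, if_true, one_ne_zero, if_false, ← Finset.sum_div]
  rw [div_div]

/-- The channels synthesized in `m + k` steps are those synthesized in `k` steps from the channels
synthesized in `m` steps. -/
theorem bitAverage_bitAverage (m k : ℕ) (W : BinaryChannel.{u}) (g : BinaryChannel.{u} → ℝ) :
    W.bitAverage (m + k) g = W.bitAverage m fun V => V.bitAverage k g := by
  induction k generalizing g with
  | zero => simp only [add_zero, bitAverage_zero]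
  | succ k ih => rw [← add_assoc, bitAverage_succ, ih]; simp only [bitAverage_succ]

theorem bitAverage_succ' (W : BinaryChannel.{u}) (n : ℕ) (g : BinaryChannel.{u} → ℝ) :
    W.bitAverage (n + 1) g = (W.minus.bitAverage n g + W.plus.bitAverage n g) / 2 := by
  rw [add_comm, bitAverage_bitAverage]
  exact (W.bitAverage_succ 0 _).trans (W.bitAverage_zero _)

theorem bitAverage_mutualInfo (W : BinaryChannel.{u}) (n : ℕ) :
    W.bitAverage n mutualInfo = W.mutualInfo := by
  induction n with
  | zero => exact W.bitAverage_zero _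
  | succ n ih =>
    rw [bitAverage_succ]; simpa only [mutualInfo_minus_add_mutualInfo_plus] using ih

theorem bitAverage_le_pow_mul {g : BinaryChannel.{u} → ℝ} {r : ℝ} (hr : 0 ≤ r)
    (h : ∀ V : BinaryChannel.{u}, (g V.minus + g V.plus) / 2 ≤ r * g V) (W : BinaryChannel.{u})
    (n : ℕ) : W.bitAverage n g ≤ r ^ n * g W := by
  induction n with
  | zero => simp [bitAverage_zero]
  | succ n ih =>
    calc _ = W.bitAverage n fun V => (g V.minus + g V.plus) / 2 := W.bitAverage_succ n g
      _ ≤ W.bitAverage n fun V => r * g V := W.bitAverage_mono n h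
      _ = r * W.bitAverage n g := W.bitAverage_const_mul n r g
      _ ≤ r * (r ^ n * g W) := by gcongr
      _ = _ := by ring

/-! ### Rough polarization -/

/-- With weights `(1 + 2z) / 4` and `(3 - 2z) / 4`, the Cauchy–Schwarz inequality bounds the square
of the sum of the two roots on the left by `3.61 z (1 - z)`; the bound on `y (1 - y)` used is
`y (1 - y) ≤ w (1 - z²)² / (1 + w)` with `w = 2z - z²`. -/
theorem _root_.Real.sqrt_contraction {z y : ℝ} (hz0 : 0 ≤ z) (hz1 : z ≤ 1) (hy0 : 0 ≤ y)
    (hy : y ≤ 2 * z - z ^ 2) (hy' : 1 - y ^ 2 ≤ (1 - z ^ 2) ^ 2) :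
    (√(y * (1 - y)) + √(z ^ 2 * (1 - z ^ 2))) / 2 ≤ 19 / 20 * √(z * (1 - z)) := by
  have hz : 0 ≤ z * (1 - z) := mul_nonneg hz0 (by linarith)
  set R := (2 - z) * (1 - z) * (1 + z) ^ 2 / (1 + 2 * z - z ^ 2) with hR
  have hd : 0 < 1 + 2 * z - z ^ 2 := by nlinarith
  have hR0 : 0 ≤ R := by
    have : 0 ≤ 2 - z := by linarith
    have : 0 ≤ 1 - z := by linarith
    positivity
  have hyR : y * (1 - y) ≤ R * (z * (1 - z)) := by
    have e : R * (z * (1 - z)) = (2 * z - z ^ 2) * (1 - z ^ 2) ^ 2 / (1 + 2 * z - z ^ 2) := by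
      rw [hR]; field_simp; ring
    rw [e]
    have h₁ : y * (1 - y) ≤ y * (1 - z ^ 2) ^ 2 / (1 + y) := by
      rw [le_div_iff₀ (by linarith)]; nlinarith
    refine h₁.trans ?_
    rw [div_le_div_iff₀ (by linarith) hd]
    nlinarith [mul_nonneg (sub_nonneg.2 hy) (sq_nonneg (1 - z ^ 2))]
  have hA : z ^ 2 * (1 - z ^ 2) = z * (1 + z) * (z * (1 - z)) := by ring
  have hA0 : 0 ≤ z * (1 + z) := by positivity
  have hsum : √R + √(z * (1 + z)) ≤ 19 / 10 := by
    have h3 : 0 < 3 - 2 * z := by linarith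
    have h1 : 0 < 1 + 2 * z := by linarith
    have hpoly : 4 * R / (3 - 2 * z) + 4 * (z * (1 + z)) / (1 + 2 * z) ≤ (19 / 10) ^ 2 := by
      have hz1' : 0 ≤ 1 - z := by linarith
      have : 4 * R / (3 - 2 * z) + 4 * (z * (1 + z)) / (1 + 2 * z) =
        (4 * ((2 - z) * (1 - z) * (1 + z) ^ 2) * (1 + 2 * z) +
          4 * (z * (1 + z)) * ((1 + 2 * z - z ^ 2) * (3 - 2 * z))) /
          ((1 + 2 * z - z ^ 2) * (3 - 2 * z) * (1 + 2 * z)) := by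
        rw [hR]; field_simp
      rw [this, div_le_iff₀ (by positivity)]
      -- The two sides are closest near `z = 0.65`, where `z² ≈ 0.43`.
      nlinarith [mul_nonneg hz0 (sq_nonneg (z ^ 2 - 43 / 100)),
        mul_nonneg hz1' (sq_nonneg (z ^ 2 - 43 / 100)),
        mul_nonneg hz0 (sq_nonneg (z - 65 / 100)), mul_nonneg hz1' (sq_nonneg (z - 65 / 100)),
        mul_nonneg hz0 (sq_nonneg (z * (z - 65 / 100))),
        mul_nonneg hz1' (sq_nonneg (z * (z - 65 / 100))), mul_nonneg hz0 hz1']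
    refine abs_le_of_sq_le_sq' ?_ (by norm_num) |>.2
    refine le_trans ?_ hpoly
    have e : 4 * R / (3 - 2 * z) + 4 * (z * (1 + z)) / (1 + 2 * z) - (√R + √(z * (1 + z))) ^ 2 =
        ((1 + 2 * z) * √R - (3 - 2 * z) * √(z * (1 + z))) ^ 2 / ((3 - 2 * z) * (1 + 2 * z)) := by
      nth_rewrite 1 [← Real.sq_sqrt hR0]
      nth_rewrite 1 [← Real.sq_sqrt hA0]
      generalize √R = a
      generalize √(z * (1 + z)) = b
      field_simp
      ring
    rw [← sub_nonneg, e]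
    positivity
  calc (√(y * (1 - y)) + √(z ^ 2 * (1 - z ^ 2))) / 2
      ≤ (√(R * (z * (1 - z))) + √(z * (1 + z) * (z * (1 - z)))) / 2 := by
        rw [hA]; gcongr
    _ = (√R + √(z * (1 + z))) / 2 * √(z * (1 - z)) := by
        rw [Real.sqrt_mul hR0, Real.sqrt_mul hA0]; ring
    _ ≤ _ := mul_le_mul_of_nonneg_right (by linarith) (Real.sqrt_nonneg _)

theorem sqrt_bhattacharyya_step (V : BinaryChannel.{u}) :
    (√(V.minus.bhattacharyya * (1 - V.minus.bhattacharyya)) +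
      √(V.plus.bhattacharyya * (1 - V.plus.bhattacharyya))) / 2 ≤
    19 / 20 * √(V.bhattacharyya * (1 - V.bhattacharyya)) := by
  rw [bhattacharyya_plus]
  exact Real.sqrt_contraction V.bhattacharyya_nonneg V.bhattacharyya_le_one
    V.minus.bhattacharyya_nonneg V.bhattacharyya_minus_le V.one_sub_sq_bhattacharyya_minus_le

theorem mutualInfo_le_indicator_add (V : BinaryChannel.{u}) {t : ℝ} (ht : 0 < t) :
    V.mutualInfo ≤ (if V.bhattacharyya ≤ t then 1 else 0) +
      √(2 / t) * √(V.bhattacharyya * (1 - V.bhattacharyya)) := by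
  have hz0 := V.bhattacharyya_nonneg
  have hz1 := V.bhattacharyya_le_one
  have h0 : 0 ≤ √(2 / t) * √(V.bhattacharyya * (1 - V.bhattacharyya)) := by positivity
  split_ifs with h
  · linarith [V.mutualInfo_le_one]
  · push Not at h
    rcases lt_or_ge V.mutualInfo 0 with hI | hI
    · linarith
    rw [zero_add, ← Real.sqrt_mul (by positivity)]
    apply Real.le_sqrt_of_sq_le
    refine (sq_mutualInfo_le hI).trans ?_
    rw [div_mul_eq_mul_div, le_div_iff₀ ht]
    nlinarith [mul_nonneg (sub_nonneg.2 hz1) (sub_nonneg.2 h.le),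
      mul_nonneg (mul_nonneg (sub_nonneg.2 hz1) ht.le) (sub_nonneg.2 hz1)]

/-- Rough polarization: up to an exponentially small error, a fraction `I(W)` of the channels
synthesized in `m` steps have exponentially small Bhattacharyya parameter. -/
theorem mutualInfo_le_bitAverage_rough (W : BinaryChannel.{u}) (m : ℕ) :
    W.mutualInfo ≤ W.bitAverage m (fun V => if V.bhattacharyya ≤ (19 / 20) ^ m then 1 else 0) +
      √2 * √(19 / 20) ^ m := by
  have hc := bitAverage_le_pow_mul (g := fun V => √(V.bhattacharyya * (1 - V.bhattacharyya)))
    (r := 19 / 20) (by norm_num) sqrt_bhattacharyya_step W m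
  have hm := W.bitAverage_mono m fun V =>
    V.mutualInfo_le_indicator_add (t := (19 / 20) ^ m) (by positivity)
  rw [bitAverage_mutualInfo, bitAverage_add, bitAverage_const_mul] at hm
  refine hm.trans (add_le_add_right ?_ _)
  have hf : √(W.bhattacharyya * (1 - W.bhattacharyya)) ≤ 1 :=
    Real.sqrt_le_one.2 (by nlinarith [W.bhattacharyya_nonneg, W.bhattacharyya_le_one])
  have e : √(2 / (19 / 20) ^ m) * (19 / 20 : ℝ) ^ m = √2 * √(19 / 20) ^ m := by
    have h1 : (19 / 20 : ℝ) ^ m = (√(19 / 20) ^ m) ^ 2 := by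
      rw [← pow_mul, mul_comm, pow_mul, Real.sq_sqrt (by norm_num)]
    have : √(19 / 20 : ℝ) ^ m ≠ 0 := by positivity
    rw [h1, Real.sqrt_div' _ (by positivity), Real.sqrt_sq (by positivity)]
    field_simp
  rw [← e]
  gcongr
  exact hc.trans (mul_le_of_le_one_right (by positivity) hf)

end BinaryChannel

/-! ### Fast polarization from an exponentially small Bhattacharyya parameter -/

namespace BinaryChannel

theorem bhattacharyya_minus_le_two_mul (W : BinaryChannel.{u}) :
    W.minus.bhattacharyya ≤ 2 * W.bhattacharyya := by
  nlinarith [W.bhattacharyya_minus_le]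

/-- If `Z(W) ≤ 2 ^ (-L)`, then the exponent `L` becomes at least `2 L` for `W⁺` and at least `L - 1`
for `W⁻`. The term `2 ^ ((K - L) / 2)` bounds the probability that the exponent ever drops below
`K`, since `√Z` decreases on average while `Z` is small. As long as the exponent is at least `K`,
its power `L ^ (-s)` shrinks on average by the factor `(2 ^ (-s) + (1 - 1 / K) ^ (-s)) / 2`, and
Markov's inequality for this power gives the other term. -/
theorem bitAverage_bad_le {s K T : ℝ} (hs : 0 < s) (hK : 2 ≤ K) (hT : 0 < T) (k : ℕ) :
    ∀ (W : BinaryChannel.{u}) (L : ℝ), 0 < L → W.bhattacharyya ≤ (2 : ℝ) ^ (-L) →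
      W.bitAverage k (fun V => if V.bhattacharyya ≤ (2 : ℝ) ^ (-T) then 0 else 1) ≤
        (2 : ℝ) ^ ((K - L) / 2) +
          T ^ s * (((2 : ℝ) ^ (-s) + (1 - 1 / K) ^ (-s)) / 2) ^ k * L ^ (-s) := by
  have hK1 : 0 < 1 - 1 / K := by
    have : 1 / K ≤ 1 / 2 := one_div_le_one_div_of_le two_pos hK
    linarith
  set r : ℝ := ((2 : ℝ) ^ (-s) + (1 - 1 / K) ^ (-s)) / 2 with hr
  have hr0 : 0 < r := by positivity
  induction k with
  | zero =>
    intro W L hL hW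
    rw [bitAverage_zero, pow_zero, mul_one]
    split_ifs with h
    · positivity
    · have hLT : L ≤ T := by
        by_contra! hlt
        exact h (hW.trans (Real.rpow_le_rpow_of_exponent_le one_le_two (by linarith)))
      have h1 : 1 ≤ T ^ s * L ^ (-s) := by
        rw [Real.rpow_neg hL.le, ← div_eq_mul_inv, one_le_div (by positivity)]
        exact Real.rpow_le_rpow hL.le hLT hs.le
      have : 0 < (2 : ℝ) ^ ((K - L) / 2) := by positivity
      linarith
  | succ k ih =>
    intro W L hL hW
    rcases lt_or_ge L K with hLK | hLK
    · have h1 : W.bitAverage (k + 1) (fun V => if V.bhattacharyya ≤ (2 : ℝ) ^ (-T) then 0 else 1) ≤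
          1 := by
        refine (W.bitAverage_mono _ fun V => ?_).trans_eq (W.bitAverage_const _ 1)
        split_ifs <;> norm_num
      have h2 : 1 ≤ (2 : ℝ) ^ ((K - L) / 2) := Real.one_le_rpow one_le_two (by linarith)
      have h3 : 0 ≤ T ^ s * r ^ (k + 1) * L ^ (-s) := by positivity
      linarith
    · have hplus := ih W.plus (2 * L) (by linarith) (by
        rw [bhattacharyya_plus]
        refine (pow_le_pow_left₀ W.bhattacharyya_nonneg hW 2).trans_eq ?_
        rw [← Real.rpow_natCast, ← Real.rpow_mul two_pos.le]
        congr 1; push_cast; ring)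
      have hminus := ih W.minus (L - 1) (by linarith) (by
        refine W.bhattacharyya_minus_le_two_mul.trans ?_
        have : (2 : ℝ) ^ (-(L - 1)) = 2 * 2 ^ (-L) := by
          rw [show -(L - 1) = 1 + -L by ring, Real.rpow_add two_pos, Real.rpow_one]
        rw [this]; linarith)
      rw [bitAverage_succ']
      have e₁ : (2 : ℝ) ^ ((K - 2 * L) / 2) ≤ 2 ^ ((K - L) / 2) * (1 / 2) := by
        rw [show (1 / 2 : ℝ) = 2 ^ (-1 : ℝ) by rw [Real.rpow_neg_one]; norm_num,
          ← Real.rpow_add two_pos]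
        exact Real.rpow_le_rpow_of_exponent_le one_le_two (by linarith)
      have e₂ : (2 : ℝ) ^ ((K - (L - 1)) / 2) ≤ 2 ^ ((K - L) / 2) * (3 / 2) := by
        rw [show (K - (L - 1)) / 2 = (K - L) / 2 + 1 / 2 by ring, Real.rpow_add two_pos,
          ← Real.sqrt_eq_rpow]
        gcongr
        exact Real.sqrt_le_iff.2 ⟨by norm_num, by norm_num⟩
      have e₃ : (2 * L) ^ (-s) = 2 ^ (-s) * L ^ (-s) := Real.mul_rpow two_pos.le hL.le
      have e₄ : (L - 1) ^ (-s) ≤ (1 - 1 / K) ^ (-s) * L ^ (-s) := by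
        rw [← Real.mul_rpow hK1.le hL.le]
        refine Real.rpow_le_rpow_of_nonpos (by positivity) ?_ (by linarith)
        rw [sub_mul, one_mul, one_div, inv_mul_eq_div]
        linarith [(one_le_div (by linarith : 0 < K)).2 hLK]
      have hc : 0 ≤ T ^ s * r ^ k := by positivity
      have e₅ : T ^ s * r ^ (k + 1) * L ^ (-s) =
          (T ^ s * r ^ k * (2 ^ (-s) * L ^ (-s)) +
            T ^ s * r ^ k * ((1 - 1 / K) ^ (-s) * L ^ (-s))) / 2 := by
        rw [pow_succ]; nth_rewrite 2 [hr]; ring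
      have e₆ := mul_le_mul_of_nonneg_left e₄ hc
      rw [e₃] at hplus
      rw [e₅]
      linarith

/-- As `s → 0` and `K → ∞`, the contraction factor of `bitAverage_bad_le` is `2 ^ (-s / 2)` to first
order. -/
theorem exists_contraction_factor_le {β : ℝ} (hβ : β < 1 / 2) :
    ∃ s K : ℝ, 0 < s ∧ 2 ≤ K ∧
      ((2 : ℝ) ^ (-s) + (1 - 1 / K) ^ (-s)) / 2 ≤ (2 : ℝ) ^ (-(s * β)) := by
  -- With `x = s log 2`, the claim for `K = ∞` reads `exp (-x / 2) * cosh (x / 2) < exp (-β x)`.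
  have hlog : 0 < Real.log 2 := Real.log_pos (by norm_num)
  obtain ⟨x, hx0, hx⟩ : ∃ x : ℝ, 0 < x ∧ x = 4 * (1 / 2 - β) := ⟨_, by linarith, rfl⟩
  have key : (Real.exp (-x) + 1) / 2 < Real.exp (-(x * β)) := by
    have hch := Real.cosh_le_exp_half_sq (x / 2)
    have e : (Real.exp (-x) + 1) / 2 = Real.exp (-(x / 2)) * Real.cosh (x / 2) := by
      rw [Real.cosh_eq, mul_div_assoc', mul_add, ← Real.exp_add, ← Real.exp_add]
      ring_nf
      rw [Real.exp_zero]
      ring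
    rw [e]
    refine (mul_le_mul_of_nonneg_left hch (Real.exp_pos _).le).trans_lt ?_
    rw [← Real.exp_add, Real.exp_lt_exp]
    nlinarith
  have hpow : ∀ y : ℝ, (2 : ℝ) ^ (-(x / Real.log 2 * y)) = Real.exp (-(x * y)) := by
    intro y
    rw [Real.rpow_def_of_pos two_pos]
    congr 1; field_simp
  have hs : 0 < x / Real.log 2 := by positivity
  have hlim : Filter.Tendsto (fun K : ℝ => ((2 : ℝ) ^ (-(x / Real.log 2)) +
      (1 - 1 / K) ^ (-(x / Real.log 2))) / 2) Filter.atTop (nhds ((Real.exp (-x) + 1) / 2)) := by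
    have h1 := hpow 1
    rw [mul_one, mul_one] at h1
    rw [h1]
    have h2 : Filter.Tendsto (fun K : ℝ => 1 - 1 / K) Filter.atTop (nhds 1) := by
      simpa using tendsto_inv_atTop_zero.const_sub (1 : ℝ)
    have h3 := h2.rpow_const (p := -(x / Real.log 2)) (Or.inl one_ne_zero)
    rw [Real.one_rpow] at h3
    exact (h3.const_add _).div_const 2
  obtain ⟨K, hK, hK2⟩ := ((hlim.eventually_lt_const key).and (Filter.eventually_ge_atTop 2)).exists
  exact ⟨x / Real.log 2, K, hs, hK2, by rw [hpow]; exact hK.le⟩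

/-- Fast polarization with an error term `C * q ^ n` that depends only on the exponent `δ`. The
first `m = ⌈γ n⌉` steps are used for rough polarization and the remaining ones to square the
Bhattacharyya parameter repeatedly, where `γ` is so small that `β (1 - γ) > δ` for some
`β < 1 / 2`. -/
theorem exists_mutualInfo_le_bitAverage_fast {δ : ℝ} (hδ0 : 0 < δ) (hδ : δ < 1 / 2) :
    ∃ C q : ℝ, 0 < C ∧ 0 < q ∧ q < 1 ∧ ∀ (W : BinaryChannel.{u}) (n : ℕ), 0 < n →
      W.mutualInfo ≤ W.bitAverage n (fun V =>
        if V.bhattacharyya ≤ (2 : ℝ) ^ (-(2 : ℝ) ^ (δ * (n : ℝ))) then 1 else 0) + C * q ^ n := by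
  obtain ⟨γ, hγ⟩ : ∃ γ : ℝ, γ = (1 / 2 - δ) / 2 := ⟨_, rfl⟩
  obtain ⟨β, hβ⟩ : ∃ β : ℝ, β = (1 / 2 + δ) / 2 := ⟨_, rfl⟩
  have hγ0 : 0 < γ := by linarith
  have hγ1 : γ < 1 := by linarith
  have hβγ : 0 < β * (1 - γ) - δ := by nlinarith
  obtain ⟨s, K, hs, hK, hfac⟩ := exists_contraction_factor_le (β := β) (by linarith)
  obtain ⟨a, ha0, ha⟩ : ∃ a : ℝ, 0 < a ∧ (2 : ℝ) ^ (-a) = 19 / 20 := by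
    refine ⟨-Real.logb 2 (19 / 20), ?_, ?_⟩
    · have := Real.logb_neg (b := 2) (by norm_num) (show (0 : ℝ) < 19 / 20 by norm_num)
        (by norm_num)
      linarith
    · rw [neg_neg, Real.rpow_logb] <;> norm_num
  have hK1 : 0 < 1 - 1 / K := by
    have : 1 / K ≤ 1 / 2 := one_div_le_one_div_of_le two_pos hK
    linarith
  -- `q₁` is the rate of the error of rough polarization and of the probability that the exponent
  -- drops below `K`; `q₂` is the rate of the term that comes from Markov's inequality.
  set q₁ : ℝ := (2 : ℝ) ^ (-(a * γ / 2)) with hq₁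
  set q₂ : ℝ := (2 : ℝ) ^ (-(s * (β * (1 - γ) - δ))) with hq₂
  have hq₁0 : 0 < q₁ := by positivity
  have hq₂0 : 0 < q₂ := by positivity
  have hq₁1 : q₁ < 1 := Real.rpow_lt_one_of_one_lt_of_neg one_lt_two (neg_lt_zero.2 (by positivity))
  have hq₂1 : q₂ < 1 := Real.rpow_lt_one_of_one_lt_of_neg one_lt_two (neg_lt_zero.2 (by positivity))
  set C₁ : ℝ := √2 + 2 ^ (K / 2) with hC₁
  set C₂ : ℝ := 2 ^ (s * β) * a ^ (-s) with hC₂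
  have hC₁0 : 0 < C₁ := by positivity
  have hC₂0 : 0 < C₂ := by positivity
  refine ⟨C₁ + C₂, max q₁ q₂, by positivity, by positivity, max_lt hq₁1 hq₂1, fun W n hn => ?_⟩
  have hn0 : (0 : ℝ) < n := by exact_mod_cast hn
  obtain ⟨m, hm⟩ : ∃ m : ℕ, m = ⌈γ * n⌉₊ := ⟨_, rfl⟩
  have hm1 : γ * n ≤ m := hm ▸ Nat.le_ceil _
  have hm2 : (m : ℝ) < γ * n + 1 := hm ▸ Nat.ceil_lt_add_one (by positivity)
  have hm0 : 0 < m := by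
    have : (0 : ℝ) < m := lt_of_lt_of_le (by positivity) hm1
    exact_mod_cast this
  have hmn : m ≤ n := by
    rw [hm]
    exact Nat.ceil_le.2 (by nlinarith)
  obtain ⟨k, rfl⟩ := Nat.exists_eq_add_of_le hmn
  have hm1' : (1 : ℝ) ≤ m := by exact_mod_cast hm0
  set T : ℝ := (2 : ℝ) ^ (δ * ((m + k : ℕ) : ℝ)) with hT
  have hT0 : 0 < T := by positivity
  have ham : ((19 : ℝ) / 20) ^ m = 2 ^ (-(a * m)) := by
    rw [← ha, ← Real.rpow_natCast, ← Real.rpow_mul two_pos.le, neg_mul]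
  have hq₁m : (2 : ℝ) ^ (-(a * m / 2)) ≤ q₁ ^ (m + k) := by
    rw [hq₁, ← Real.rpow_natCast, ← Real.rpow_mul two_pos.le]
    refine Real.rpow_le_rpow_of_exponent_le one_le_two ?_
    nlinarith [mul_le_mul_of_nonneg_left hm1 ha0.le]
  have hE₁ : √2 * √(19 / 20) ^ m ≤ √2 * q₁ ^ (m + k) := by
    gcongr
    refine le_of_eq_of_le ?_ hq₁m
    rw [← ha, Real.sqrt_eq_rpow, ← Real.rpow_natCast, ← Real.rpow_mul two_pos.le,
      ← Real.rpow_mul two_pos.le]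
    congr 1; ring
  have hE₂ : (2 : ℝ) ^ ((K - a * m) / 2) ≤ 2 ^ (K / 2) * q₁ ^ (m + k) := by
    rw [show (K - a * m) / 2 = K / 2 + -(a * m / 2) by ring, Real.rpow_add two_pos]
    gcongr
  have hE₃ : T ^ s * (((2 : ℝ) ^ (-s) + (1 - 1 / K) ^ (-s)) / 2) ^ k * (a * m) ^ (-s) ≤
      C₂ * q₂ ^ (m + k) := by
    have h1 : (a * m) ^ (-s) ≤ a ^ (-s) :=
      Real.rpow_le_rpow_of_nonpos ha0 (le_mul_of_one_le_right ha0.le hm1') (by linarith)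
    have h2 : (((2 : ℝ) ^ (-s) + (1 - 1 / K) ^ (-s)) / 2) ^ k ≤ ((2 : ℝ) ^ (-(s * β))) ^ k :=
      pow_le_pow_left₀ (by positivity) hfac k
    have h3 : T ^ s * ((2 : ℝ) ^ (-(s * β))) ^ k ≤ 2 ^ (s * β) * q₂ ^ (m + k) := by
      rw [hT, hq₂, ← Real.rpow_natCast, ← Real.rpow_natCast, ← Real.rpow_mul two_pos.le,
        ← Real.rpow_mul two_pos.le, ← Real.rpow_mul two_pos.le, ← Real.rpow_add two_pos,
        ← Real.rpow_add two_pos]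
      refine Real.rpow_le_rpow_of_exponent_le one_le_two ?_
      push_cast at hm2 ⊢
      have : 0 < s * β := mul_pos hs (by linarith)
      nlinarith [mul_lt_mul_of_pos_left hm2 this]
    calc _ ≤ T ^ s * ((2 : ℝ) ^ (-(s * β))) ^ k * a ^ (-s) := by gcongr
      _ ≤ 2 ^ (s * β) * q₂ ^ (m + k) * a ^ (-s) := by gcongr
      _ = _ := by rw [hC₂]; ring
  set B : ℝ := 2 ^ ((K - a * m) / 2) +
    T ^ s * (((2 : ℝ) ^ (-s) + (1 - 1 / K) ^ (-s)) / 2) ^ k * (a * m) ^ (-s) with hB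
  have hB0 : 0 ≤ B := by positivity
  have hstep : ∀ V : BinaryChannel.{u},
      (if V.bhattacharyya ≤ (19 / 20 : ℝ) ^ m then (1 : ℝ) else 0) ≤
        V.bitAverage k (fun U => if U.bhattacharyya ≤ (2 : ℝ) ^ (-T) then 1 else 0) + B := by
    intro V
    have hpos : 0 ≤ V.bitAverage k
        (fun U => if U.bhattacharyya ≤ (2 : ℝ) ^ (-T) then 1 else 0) := by
      refine (V.bitAverage_const k 0).symm.trans_le (V.bitAverage_mono k fun U => ?_)
      split_ifs <;> norm_num
    split_ifs with hV
    · rw [ham] at hV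
      have h1 := bitAverage_bad_le hs hK hT0 k V (a * m) (by positivity) hV
      have h2 := V.bitAverage_add k
        (fun U => if U.bhattacharyya ≤ (2 : ℝ) ^ (-T) then 1 else 0)
        (fun U => if U.bhattacharyya ≤ (2 : ℝ) ^ (-T) then 0 else 1)
      have h3 : V.bitAverage k (fun U => (if U.bhattacharyya ≤ (2 : ℝ) ^ (-T) then (1 : ℝ) else 0) +
          (if U.bhattacharyya ≤ (2 : ℝ) ^ (-T) then 0 else 1)) = 1 := by
        refine Eq.trans ?_ (V.bitAverage_const k 1)
        congr 1
        funext U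
        split_ifs <;> norm_num
      linarith
    · linarith
  have h1 := W.mutualInfo_le_bitAverage_rough m
  have h2 := W.bitAverage_mono m hstep
  rw [bitAverage_add, bitAverage_const, ← bitAverage_bitAverage] at h2
  have h3 : q₁ ^ (m + k) ≤ max q₁ q₂ ^ (m + k) := pow_le_pow_left₀ hq₁0.le (le_max_left _ _) _
  have h4 : q₂ ^ (m + k) ≤ max q₁ q₂ ^ (m + k) := pow_le_pow_left₀ hq₂0.le (le_max_right _ _) _
  have h5 := mul_le_mul_of_nonneg_left h3 hC₁0.le
  have h6 := mul_le_mul_of_nonneg_left h4 hC₂0.le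
  rw [hC₁] at h5
  linarith

/-! ### Absorbing the constant -/

theorem bhattacharyya_bitChannel_le (W : BinaryChannel.{u}) (n i : ℕ) :
    (W.bitChannel n i).bhattacharyya ≤ 2 ^ n * W.bhattacharyya := by
  induction n generalizing i with
  | zero => simp [bitChannel]
  | succ n ih =>
    have h := ih (i / 2)
    have h0 := (W.bitChannel n (i / 2)).bhattacharyya_nonneg
    have h1 := (W.bitChannel n (i / 2)).bhattacharyya_le_one
    rw [bitChannel, pow_succ]
    split_ifs
    · linarith [(W.bitChannel n (i / 2)).bhattacharyya_minus_le_two_mul]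
    · rw [bhattacharyya_plus]; nlinarith

end BinaryChannel

theorem propositionp (δ : ℝ) (hδ_pos : 0 < δ) (hδ_lt : δ < 1 / 2) :
    ∃ c : ℝ, 0 < c ∧
      ∀ (W : BinaryChannel.{u}) (ε : ℝ), 0 < ε →
        ∀ n₀ : ℕ, c * Real.log (1 / ε) < (n₀ : ℝ) →
          W.mutualInfo - ε ≤
            (((Finset.range (2 ^ n₀)).filter fun i =>
              (W.bitChannel n₀ i).bhattacharyya ≤ (2 : ℝ) ^ (-(2 : ℝ) ^ (δ * (n₀ : ℝ)))).card : ℝ)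
              / (2 : ℝ) ^ n₀ := by
  obtain ⟨C, q, hC, hq0, hq1, hfast⟩ :=
    BinaryChannel.exists_mutualInfo_le_bitAverage_fast.{u} hδ_pos hδ_lt
  -- For `n ≥ N`, the error `C * q ^ n` is at most `√q ^ n`, which is below `ε` if `c` is large.
  have hsq0 : 0 < √q := Real.sqrt_pos.2 hq0
  have hsq1 : √q < 1 := (Real.sqrt_lt' one_pos).2 (by simpa using hq1)
  obtain ⟨N, hN⟩ : ∃ N : ℕ, ∀ n, N ≤ n → C * √q ^ n ≤ 1 := by
    have h := (tendsto_pow_atTop_nhds_zero_of_lt_one hsq0.le hsq1).const_mul C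
    rw [mul_zero] at h
    exact Filter.eventually_atTop.1 (h.eventually_le_const one_pos)
  -- For `n < N`, a large `c` forces `I(W)` so close to `1` that every synthesized channel is good.
  obtain ⟨t, ht0, ht⟩ : ∃ t : ℝ, 0 < t ∧ ∀ n < N,
      2 ^ n * √t ≤ (2 : ℝ) ^ (-(2 : ℝ) ^ (δ * (n : ℝ))) := by
    obtain ⟨b, hb⟩ : ∃ b : ℝ, b = (2 : ℝ) ^ (-(2 : ℝ) ^ (δ * (N : ℝ))) / 2 ^ N := ⟨_, rfl⟩
    have hb0 : 0 < b := by rw [hb]; positivity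
    refine ⟨b ^ 2, by positivity, fun n hn => ?_⟩
    rw [Real.sqrt_sq hb0.le]
    calc (2 : ℝ) ^ n * b ≤ 2 ^ N * b := by gcongr; norm_num
      _ = (2 : ℝ) ^ (-(2 : ℝ) ^ (δ * (N : ℝ))) := by rw [hb]; field_simp
      _ ≤ _ := by
        refine Real.rpow_le_rpow_of_exponent_le one_le_two (neg_le_neg ?_)
        refine Real.rpow_le_rpow_of_exponent_le one_le_two ?_
        gcongr
  have hlq : Real.log √q < 0 := Real.log_neg hsq0 hsq1
  refine ⟨max (-1 / Real.log √q) (2 * N / t + 1), lt_max_of_lt_left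
    (div_pos_of_neg_of_neg (by norm_num) hlq), fun W ε hε n hn => ?_⟩
  have hcard : (((Finset.range (2 ^ n)).filter fun i =>
      (W.bitChannel n i).bhattacharyya ≤ (2 : ℝ) ^ (-(2 : ℝ) ^ (δ * (n : ℝ)))).card : ℝ) / 2 ^ n =
      W.bitAverage n (fun V =>
        if V.bhattacharyya ≤ (2 : ℝ) ^ (-(2 : ℝ) ^ (δ * (n : ℝ))) then 1 else 0) := by
    rw [BinaryChannel.bitAverage, Finset.card_filter]
    push_cast
    rfl
  rcases le_or_gt W.mutualInfo ε with hI | hI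
  · exact (sub_nonpos.2 hI).trans (by positivity)
  rw [one_div, Real.log_inv] at hn
  have hε1 : ε < 1 := hI.trans_le W.mutualInfo_le_one
  have hlε : 0 < -Real.log ε := neg_pos.2 (Real.log_neg hε hε1)
  have hc₁ : -1 / Real.log √q * -Real.log ε < n :=
    (mul_le_mul_of_nonneg_right (le_max_left _ _) hlε.le).trans_lt hn
  have hc₂ : (2 * N / t + 1) * -Real.log ε < n :=
    (mul_le_mul_of_nonneg_right (le_max_right _ _) hlε.le).trans_lt hn
  have hn0 : 0 < n := by
    have : 0 < (2 * N / t + 1) * -Real.log ε := by positivity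
    exact_mod_cast this.trans hc₂
  rw [hcard]
  rcases lt_or_ge n N with hnN | hnN
  · have hgood : ∀ i, (W.bitChannel n i).bhattacharyya ≤ (2 : ℝ) ^ (-(2 : ℝ) ^ (δ * (n : ℝ))) := by
      intro i
      refine (W.bhattacharyya_bitChannel_le n i).trans (le_trans ?_ (ht n hnN))
      gcongr
      apply Real.le_sqrt_of_sq_le
      have h1 := BinaryChannel.sq_mutualInfo_le (hε.le.trans hI.le)
      have hNn : (n : ℝ) < N := by exact_mod_cast hnN
      have h2 : 2 * (1 - ε) ≤ t := by
        have h3 : 1 - ε ≤ -Real.log ε := by linarith [Real.log_le_sub_one_of_pos hε]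
        have h4 : 2 * N / t * (1 - ε) ≤ N := by
          have : 0 ≤ 2 * N / t := by positivity
          nlinarith
        have h5 : (N : ℝ) * (2 * (1 - ε)) ≤ N * t := by
          rw [div_mul_eq_mul_div, div_le_iff₀ ht0] at h4
          linarith
        exact le_of_mul_le_mul_left h5 (by linarith [n.cast_nonneg (α := ℝ)])
      nlinarith
    have : W.bitAverage n (fun V =>
        if V.bhattacharyya ≤ (2 : ℝ) ^ (-(2 : ℝ) ^ (δ * (n : ℝ))) then 1 else 0) = 1 := by
      simp [BinaryChannel.bitAverage, hgood]
    rw [this]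
    linarith [W.mutualInfo_le_one]
  · have h1 := hfast W n hn0
    have h2 : √q ^ n ≤ ε := by
      rw [← Real.log_le_log_iff (by positivity) hε, Real.log_pow]
      rw [div_mul_eq_mul_div, div_lt_iff_of_neg hlq] at hc₁
      linarith
    have h3 : C * q ^ n ≤ √q ^ n := by
      have e : q ^ n = √q ^ n * √q ^ n := by rw [← mul_pow, Real.mul_self_sqrt hq0.le]
      rw [e, ← mul_assoc]
      exact mul_le_of_le_one_left (by positivity) (hN n hnN)
    linarith
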